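/- **Proposition 5.1.** A *quasimodular form* of weight $2k$ for $\mathrm{SL}_2(\mathbb{Z})$ is a function on the upper half plane of the form $f=\sum_{j=0}^{k}E_2^{\,j}f_j$, where $f_j$ is a modular form of weight $2k-2j$ for $\mathrm{SL}_2(\mathbb{Z})$ and $E_2(z)=1-24\sum_{n\ge 1}\big(\sum_{d\mid n}d\big)q^n$ with $q=e^{2\pi i z}$. It has a Fourier expansion $f=\sum_{n\ge 0}a_f(n)q^n$. Let $\widetilde{M}_{2k}^{\mathbb{Z}}$ denote the set of quasimodular forms $f$ of weight $2k$ with $a_f(n)\in\mathbb{Z}$ for all $n\ge 0$. Let $k\ge 1$ be an integer. The first $k^2\,k^k\,k^{k^k}$ Fourier coefficients of a form in $\widetilde{M}_{2k}^{\mathbb{Z}}$ determine it uniquely: if $f,g\in\widetilde{M}_{2k}^{\mathbb{Z}}$ satisfy $a_f(n)=a_g(n)$ for all integers $0\le n<k^2\,k^k\,k^{k^k}$, then $f=g$. -/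

import Mathlib

open UpperHalfPlane
open scoped MatrixGroups Manifold

/-- Quasimodular forms of (pure) weight `2k` for `SL₂(ℤ)`: the functions on the upper half plane of
the form `∑_{j=0}^{k} E₂ ^ j * f_j`, where `f_j` is a modular form of weight `2k - 2j` for
`SL₂(ℤ)`. -/
def IsQuasimodular (k : ℕ) (f : ℍ → ℂ) : Prop :=
  ∃ F : (j : Fin (k + 1)) → ModularForm 𝒮ℒ (2 * (k : ℤ) - 2 * ((j : ℕ) : ℤ)),
    ∀ z : ℍ, f z = ∑ j : Fin (k + 1), EisensteinSeries.E2 z ^ (j : ℕ) * F j z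

/-- The `n`-th Fourier coefficient `a_f(n)` of `f` at `∞`, with respect to `q = exp(2πiz)`. -/
noncomputable def qCoeff (f : ℍ → ℂ) (n : ℕ) : ℂ :=
  (qExpansion 1 f).coeff n

/-- Quasimodular forms of weight `2k` for `SL₂(ℤ)` all of whose Fourier coefficients are
integers. -/
def IsIntegralQuasimodular (k : ℕ) (f : ℍ → ℂ) : Prop :=
  IsQuasimodular k f ∧ ∀ n : ℕ, ∃ a : ℤ, qCoeff f n = (a : ℂ)

/-- The Fourier expansion of a quasimodular form converges to it: the coefficients above are the
genuine ones. -/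
theorem IsQuasimodular.hasSum {k : ℕ} {f : ℍ → ℂ} (hf : IsQuasimodular k f) (z : ℍ) :
    HasSum (fun n : ℕ => qCoeff f n * Complex.exp (2 * Real.pi * Complex.I * z) ^ n)
      (f z) := by
  obtain ⟨F, hF⟩ := hf
  have hE2per : Function.Periodic (EisensteinSeries.E2 ∘ ofComplex) ((1 : ℝ) : ℂ) := by
    intro w
    by_cases hw : 0 < w.im
    · have h1 : 0 < (w + ((1 : ℝ) : ℂ)).im := by simpa using hw
      simp only [Function.comp_apply, ofComplex_apply_of_im_pos h1, ofComplex_apply_of_im_pos hw,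
        EisensteinSeries.E2_eq_tsum_cexp]
      have hq : Complex.exp (2 * Real.pi * Complex.I * (w + ((1 : ℝ) : ℂ))) =
          Complex.exp (2 * Real.pi * Complex.I * w) := by
        simp [mul_add, Complex.exp_add]
      refine congrArg (fun t : ℂ => 1 - 24 * t) (tsum_congr fun n => ?_)
      exact congrArg (fun t : ℂ => _ * t ^ (n : ℕ)) hq
    · have h1 : (w + ((1 : ℝ) : ℂ)).im ≤ 0 := by simpa using hw
      simp only [Function.comp_apply, ofComplex_apply_of_im_nonpos h1,
        ofComplex_apply_of_im_nonpos (not_lt.mp hw)]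
  have hE2hol : ∀ n : ℕ, MDiff (EisensteinSeries.E2 ^ n) := fun n => by
    induction n with
    | zero => exact mdifferentiable_const (c := (1 : ℂ))
    | succ n ih => simpa only [pow_succ] using! ih.mul E2_mdifferentiable
  have hE2bdd : ∀ n : ℕ, IsBoundedAtImInfty (EisensteinSeries.E2 ^ n) := fun n => by
    induction n with
    | zero => exact Filter.const_boundedAtFilter _ 1
    | succ n ih =>
      rw [pow_succ]
      exact ih.mul EisensteinSeries.isBoundedAtImInfty_E2
  have hf' : f = ∑ j : Fin (k + 1), EisensteinSeries.E2 ^ (j : ℕ) * ⇑(F j) := by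
    ext z; simp [hF]
  have hper : Function.Periodic (f ∘ ofComplex) ((1 : ℝ) : ℂ) := by
    intro w
    simp only [Function.comp_apply, hF]
    refine Finset.sum_congr rfl fun j _ => ?_
    have h1 := hE2per w
    have h2 := SlashInvariantFormClass.periodic_comp_ofComplex (h := 1) (F j) (by simp) w
    simp only [Function.comp_apply] at h1 h2
    rw [h1, h2]
  have hhol : MDiff f := by
    rw [hf']
    refine MDifferentiable.sum fun j _ => ?_
    exact (hE2hol _).mul (ModularFormClass.holo (F j))
  have hbdd : IsBoundedAtImInfty f := by
    rw [hf']
    refine Finset.sum_induction _ IsBoundedAtImInfty (fun _ _ => .add) ?_ fun j _ => ?_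
    · exact Filter.const_boundedAtFilter _ 0
    · exact .mul (hE2bdd _) (ModularFormClass.bdd_at_infty (F j))
  have := z.hasSum_qExpansion one_pos hper hhol hbdd
  simpa [qCoeff, Function.Periodic.qParam] using this

/-! Write `f - g` as `P(E₂)`, with `P` a polynomial of degree at most `k` whose coefficients are
modular. The claim follows from a zero estimate, `eq_zero_of_X_pow_dvd_eval`: if `deg P ≤ p`, `P`
has weight `w`, and `P(E₂)` vanishes at `q = 0` to order greater than `2 ^ p * w / 12`, then `P =
0`. For `p = k` and `w = 2k` this is far below the stated bound.

The estimate is by induction on `p`, starting from the Sturm bound. Let `D = q d/dq`. The form `T =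
D f - (w - p)/12 * E₂ f` again has degree at most `p` in `E₂` and vanishes at least as deeply as
`f`. Eliminating `E₂ ^ p` between `f` and `T` gives a form of lower degree and at most twice the
weight, which vanishes by induction. Hence `T = ρ f` with `ρ` free of `E₂`. Differentiating this
formally in `E₂`, with `g = ∂f/∂E₂`, yields `g * D f - f * D g = (p/12) f²`, that is, `D (g / f) =
-p/12`. No Laurent series has a nonzero constant as its image under `D` (`mul_qDeriv_sub_ne`), so `f
= 0`, and `P = 0` because `E₂` is transcendental over modular forms. -/

open scoped ModularForm

/-! ### Bounded periodic functions and their `q`-expansions -/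

/-- The subring of `1`-periodic holomorphic functions on the upper half plane that are bounded at
`i∞`. -/
def boundedPeriodic : Subring (ℍ → ℂ) where
  carrier := {f | Function.Periodic (f ∘ ofComplex) ((1 : ℝ) : ℂ) ∧ MDiff f ∧ IsBoundedAtImInfty f}
  mul_mem' ha hb := ⟨ha.1.mul hb.1, ha.2.1.mul hb.2.1, ha.2.2.mul hb.2.2⟩
  one_mem' := ⟨fun _ => rfl, mdifferentiable_const (c := (1 : ℂ)),
    Filter.const_boundedAtFilter _ 1⟩
  add_mem' ha hb := ⟨ha.1.add hb.1, ha.2.1.add hb.2.1, ha.2.2.add hb.2.2⟩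
  zero_mem' := ⟨fun _ => rfl, mdifferentiable_const (c := (0 : ℂ)),
    Filter.const_boundedAtFilter _ 0⟩
  neg_mem' ha := ⟨fun w => congrArg Neg.neg (ha.1 w), ha.2.1.neg, ha.2.2.neg⟩

namespace boundedPeriodic

lemma analyticAt_cuspFunction {f : ℍ → ℂ} (hf : f ∈ boundedPeriodic) :
    AnalyticAt ℂ (cuspFunction 1 f) 0 :=
  analyticAt_cuspFunction_zero one_pos hf.1 hf.2.1 hf.2.2

/-- The `q`-expansion as a ring homomorphism. -/
noncomputable def qExp : boundedPeriodic →+* PowerSeries ℂ where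
  toFun f := qExpansion 1 (f : ℍ → ℂ)
  map_one' := qExpansion_one 1
  map_zero' := qExpansion_zero 1
  map_mul' f g := qExpansion_mul (analyticAt_cuspFunction f.2) (analyticAt_cuspFunction g.2)
  map_add' f g := qExpansion_add (analyticAt_cuspFunction f.2) (analyticAt_cuspFunction g.2)

lemma qExp_injective : Function.Injective qExp := by
  rw [injective_iff_map_eq_zero]
  intro f hf
  exact Subtype.ext ((qExpansion_eq_zero_iff one_pos f.2.1 f.2.2.1 f.2.2.2).1 hf)

lemma mem_of_hasSum {f : ℍ → ℂ} {c : ℕ → ℂ} (hol : MDiff f)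
    (hf : ∀ τ : ℍ, HasSum (fun m => c m • Function.Periodic.qParam 1 τ ^ m) (f τ)) :
    f ∈ boundedPeriodic := by
  refine ⟨fun w => ?_, hol, isBoundedAtImInfty_of_hasSum_qExpansion one_pos hf⟩
  by_cases hw : 0 < w.im
  · have h1 : 0 < (w + ((1 : ℝ) : ℂ)).im := by simpa using hw
    simp only [Function.comp_apply, ofComplex_apply_of_im_pos h1, ofComplex_apply_of_im_pos hw]
    have h2 := hf ⟨w + ((1 : ℝ) : ℂ), h1⟩
    have h3 : Function.Periodic.qParam 1 (w + ((1 : ℝ) : ℂ)) = Function.Periodic.qParam 1 w := by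
      simp [Function.Periodic.qParam, mul_add, Complex.exp_add]
    change HasSum (fun m => c m • Function.Periodic.qParam 1 (w + ((1 : ℝ) : ℂ)) ^ m) _ at h2
    rw [h3] at h2
    exact h2.unique (hf ⟨w, hw⟩)
  · have h1 : (w + ((1 : ℝ) : ℂ)).im ≤ 0 := by simpa using hw
    simp only [Function.comp_apply, ofComplex_apply_of_im_nonpos h1,
      ofComplex_apply_of_im_nonpos (not_lt.mp hw)]

lemma E2_mem : EisensteinSeries.E2 ∈ boundedPeriodic :=
  mem_of_hasSum E2_mdifferentiable fun τ => by
    simpa only [Function.Periodic.qParam, Complex.ofReal_one, div_one] using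
      EisensteinSeries.hasSum_qExpansion_E2 (z := τ)

lemma smul_mem (a : ℂ) {f : ℍ → ℂ} (hf : f ∈ boundedPeriodic) : a • f ∈ boundedPeriodic :=
  ⟨fun w => congrArg (a • ·) (hf.1 w), hf.2.1.const_smul a, hf.2.2.smul a⟩

lemma modularForm_mem {w : ℤ} (F : ModularForm 𝒮ℒ w) : ⇑F ∈ boundedPeriodic :=
  ⟨SlashInvariantFormClass.periodic_comp_ofComplex (h := 1) F (by simp), ModularFormClass.holo F,
    ModularFormClass.bdd_at_infty F⟩

open Derivative in
-- By the chain rule through `q = exp(2πiz)`, the normalized derivative is `q d/dq` of the cusp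
-- function, whose Taylor series converges on the whole unit disc.
lemma hasSum_normalizedDeriv {f : ℍ → ℂ} (hf : f ∈ boundedPeriodic) (τ : ℍ) :
    HasSum (fun m : ℕ => ((m : ℂ) * (qExpansion 1 f).coeff m) • Function.Periodic.qParam 1 τ ^ m)
      (normalizedDerivOfComplex f τ) := by
  set c := cuspFunction 1 f
  set q := Function.Periodic.qParam 1 (τ : ℂ) with hq
  have hq1 : ‖q‖ < 1 := Function.Periodic.norm_qParam_lt_one one_pos τ.im_pos
  have hd : DifferentiableOn ℂ c (Metric.ball 0 1) :=
    differentiableOn_cuspFunction_ball one_pos hf.1 hf.2.1 hf.2.2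
  have h1 : normalizedDerivOfComplex f τ = q * deriv c q := by
    have e : f ∘ ofComplex =ᶠ[nhds (τ : ℂ)] fun w => c (Function.Periodic.qParam 1 w) := by
      filter_upwards [isOpen_upperHalfPlaneSet.mem_nhds τ.im_pos] with w hw
      simpa [ofComplex_apply_of_im_pos hw] using
        (eq_cuspFunction (⟨w, hw⟩ : ℍ) one_ne_zero hf.1).symm
    have dq : HasDerivAt (Function.Periodic.qParam 1) (2 * Real.pi * Complex.I * q) (τ : ℂ) := by
      have : HasDerivAt (fun w : ℂ => Complex.exp (2 * Real.pi * Complex.I * w / ((1 : ℝ) : ℂ)))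
          (Complex.exp (2 * Real.pi * Complex.I * τ / ((1 : ℝ) : ℂ)) *
            (2 * Real.pi * Complex.I * 1 / ((1 : ℝ) : ℂ))) (τ : ℂ) :=
        (((hasDerivAt_id (τ : ℂ)).const_mul _).div_const _).cexp
      refine this.congr_deriv ?_
      simp [Function.Periodic.qParam, hq, mul_comm]
    have dc : HasDerivAt c (deriv c q) q :=
      (hd.differentiableAt (Metric.isOpen_ball.mem_nhds (by simpa using hq1))).hasDerivAt
    have := ((dc.comp (τ : ℂ) dq).congr_of_eventuallyEq e).deriv
    rw [normalizedDerivOfComplex, this]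
    field_simp [Complex.two_pi_I_ne_zero]
  have h2 := Complex.hasSum_taylorSeries_on_ball (hd.deriv Metric.isOpen_ball)
    (z := q) (by simpa using hq1)
  have h3 := h2.mul_left q
  rw [h1, ← hasSum_nat_add_iff' 1]
  simp only [Finset.sum_range_one, Nat.cast_zero, zero_mul, zero_smul, sub_zero]
  convert! h3 using 2 with m
  simp only [qExpansion_coeff, iteratedDeriv_succ', Nat.factorial_succ, smul_eq_mul, sub_zero,
    pow_succ, Nat.cast_mul]
  have : ((m + 1 : ℕ) : ℂ) ≠ 0 := Nat.cast_ne_zero.2 m.succ_ne_zero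
  field_simp
  change iteratedDeriv m (deriv c) 0 * q ^ m * q / (m.factorial : ℂ) = _
  ring

end boundedPeriodic

/-- The derivation `q d/dq` of the ring of power series in `q`. -/
noncomputable def qDeriv : Derivation ℂ (PowerSeries ℂ) (PowerSeries ℂ) :=
  (PowerSeries.X : PowerSeries ℂ) • PowerSeries.derivative ℂ

lemma qDeriv_apply (φ : PowerSeries ℂ) :
    qDeriv φ = PowerSeries.X * PowerSeries.derivative ℂ φ := rfl

lemma coeff_qDeriv (φ : PowerSeries ℂ) (n : ℕ) :
    (qDeriv φ).coeff n = n * φ.coeff n := by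
  cases n with
  | zero => simp [qDeriv_apply]
  | succ n => simp [qDeriv_apply, PowerSeries.coeff_succ_X_mul, PowerSeries.coeff_derivative,
      mul_comm]

namespace boundedPeriodic

open Derivative

lemma normalizedDeriv_mem {f : ℍ → ℂ} (hf : f ∈ boundedPeriodic) :
    normalizedDerivOfComplex f ∈ boundedPeriodic :=
  mem_of_hasSum (normalizedDerivOfComplex_mdifferentiable hf.2.1) (hasSum_normalizedDeriv hf)

lemma qExpansion_normalizedDeriv {f : ℍ → ℂ} (hf : f ∈ boundedPeriodic) :
    qExpansion 1 (normalizedDerivOfComplex f) = qDeriv (qExpansion 1 f) := by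
  ext m
  rw [coeff_qDeriv]
  have hD := normalizedDeriv_mem hf
  have h1 := hasFPowerSeriesOnBall_cuspFunction one_pos (analyticAt_cuspFunction hD)
    (hasSum_normalizedDeriv hf)
  have h2 := hasFPowerSeriesOnBall_cuspFunction one_pos (analyticAt_cuspFunction hD)
    (hasSum_qExpansion one_pos hD.1 hD.2.1 hD.2.2)
  simpa using congrArg (FormalMultilinearSeries.coeff · m)
    (h2.hasFPowerSeriesAt.eq_formalMultilinearSeries h1.hasFPowerSeriesAt)

end boundedPeriodic

/-! ### Modular power series and the Serre derivative -/

/-- A power series is modular of weight `w` if it is the `q`-expansion of a modular form of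
weight `w` and level one. -/
def IsModularSeries (w : ℤ) (φ : PowerSeries ℂ) : Prop :=
  ∃ F : ModularForm 𝒮ℒ w, qExpansion 1 F = φ

/-- The `q`-expansion of `E₂`. -/
noncomputable def e2Series : PowerSeries ℂ := qExpansion 1 EisensteinSeries.E2

namespace IsModularSeries

lemma of_slash_eq {w : ℤ} {f : ℍ → ℂ} (hf : f ∈ boundedPeriodic)
    (h : ∀ γ : SL(2, ℤ), f ∣[w] γ = f) : IsModularSeries w (qExpansion 1 f) :=
  ⟨{ toFun := f
     slash_action_eq' := fun _ ⟨γ, hγ⟩ => hγ ▸ h γ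
     holo' := hf.2.1
     bdd_at_cusps' := fun {c} hc => by
      rw [Subgroup.IsArithmetic.isCusp_iff_isCusp_SL2Z] at hc
      rw [OnePoint.isBoundedAt_iff_forall_SL2Z hc]
      intro γ _
      rw [h γ]
      exact hf.2.2 }, rfl⟩

variable {w v : ℤ} {φ ψ : PowerSeries ℂ}

lemma zero (w : ℤ) : IsModularSeries w 0 := ⟨0, qExpansion_zero 1⟩

lemma cast (h : IsModularSeries w φ) (hwv : w = v) : IsModularSeries v φ := hwv ▸ h

lemma add (hφ : IsModularSeries w φ) (hψ : IsModularSeries w ψ) : IsModularSeries w (φ + ψ) := by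
  obtain ⟨F, rfl⟩ := hφ
  obtain ⟨G, rfl⟩ := hψ
  exact ⟨F + G, ModularForm.qExpansion_add one_pos one_mem_strictPeriods_SL F G⟩

lemma smul (c : ℂ) (hφ : IsModularSeries w φ) : IsModularSeries w (c • φ) := by
  obtain ⟨F, rfl⟩ := hφ
  exact ⟨c • F, ModularForm.qExpansion_smul one_pos one_mem_strictPeriods_SL c F⟩

lemma neg (hφ : IsModularSeries w φ) : IsModularSeries w (-φ) := by
  simpa using hφ.smul (-1)

lemma sub (hφ : IsModularSeries w φ) (hψ : IsModularSeries w ψ) : IsModularSeries w (φ - ψ) := by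
  simpa [sub_eq_add_neg] using hφ.add hψ.neg

lemma mul (hφ : IsModularSeries w φ) (hψ : IsModularSeries v ψ) :
    IsModularSeries (w + v) (φ * ψ) := by
  obtain ⟨F, rfl⟩ := hφ
  obtain ⟨G, rfl⟩ := hψ
  exact ⟨F.mul G, ModularForm.qExpansion_mul one_pos one_mem_strictPeriods_SL F G⟩

lemma eq_zero_of_X_pow_dvd (hφ : IsModularSeries w φ) {N : ℕ} (hN : w.toNat / 12 < N)
    (h : PowerSeries.X ^ N ∣ φ) : φ = 0 := by
  obtain ⟨F, rfl⟩ := hφ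
  have : F = 0 := ModularForm.sturm_bound_levelOne
    (lt_of_lt_of_le (Nat.cast_lt.2 hN)
      (PowerSeries.nat_le_order _ N (PowerSeries.X_pow_dvd_iff.1 h)))
  rw [this]
  exact qExpansion_zero 1

open Derivative boundedPeriodic

lemma serre (hφ : IsModularSeries w φ) :
    IsModularSeries (w + 2) (qDeriv φ - ((w : ℂ) / 12) • (e2Series * φ)) := by
  obtain ⟨F, rfl⟩ := hφ
  have hF := modularForm_mem F
  have hD := normalizedDeriv_mem hF
  have hEF := boundedPeriodic.mul_mem E2_mem hF
  have hc := smul_mem ((w : ℂ) / 12) hEF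
  have he : serreDerivative w F =
      normalizedDerivOfComplex F - ((w : ℂ) / 12) • (EisensteinSeries.E2 * ⇑F) := by
    ext z
    simp [div_eq_mul_inv, mul_assoc]
  have h := of_slash_eq (w := w + 2) (f := serreDerivative w F)
    (he ▸ boundedPeriodic.sub_mem hD hc) fun γ =>
      serreDerivative_slash_invariant hF.2.1 (F.slash_action_eq' _ ⟨γ, rfl⟩)
  rwa [he, qExpansion_sub (analyticAt_cuspFunction hD) (analyticAt_cuspFunction hc),
    qExpansion_smul (analyticAt_cuspFunction hEF),
    qExpansion_mul (analyticAt_cuspFunction E2_mem) (analyticAt_cuspFunction hF),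
    qExpansion_normalizedDeriv hF] at h

end IsModularSeries

/-! ### Transformation of `E₂` and its derivative -/

open EisensteinSeries in
lemma E2_slash_apply (γ : SL(2, ℤ)) (z : ℍ) : (E2 ∣[(2 : ℤ)] γ) z =
    E2 z - 6 * Complex.I / Real.pi * (γ 1 0) * (denom γ z) ^ (-1 : ℤ) := by
  have hz : denom γ z ≠ 0 := denom_ne_zero γ z
  have hpi : (Real.pi : ℂ) ≠ 0 := Complex.ofReal_ne_zero.2 Real.pi_ne_zero
  rw [E2_slash_action]
  simp only [Pi.sub_apply, Pi.smul_apply, D2, riemannZeta_two, smul_eq_mul, zpow_neg_one]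
  field_simp

open Derivative EisensteinSeries in
lemma normalizedDeriv_slash_E2 (γ : SL(2, ℤ)) (z : ℍ) :
    normalizedDerivOfComplex (E2 ∣[(2 : ℤ)] γ) z = normalizedDerivOfComplex E2 z
      + 3 / Real.pi ^ 2 * (γ 1 0 / denom γ z) ^ 2 := by
  have e : (E2 ∣[(2 : ℤ)] γ) ∘ ofComplex =ᶠ[nhds (z : ℂ)] fun w => (E2 ∘ ofComplex) w -
      6 * Complex.I / Real.pi * (γ 1 0) * (denom γ w) ^ (-1 : ℤ) := by
    filter_upwards [isOpen_upperHalfPlaneSet.mem_nhds z.im_pos] with w hw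
    simpa [ofComplex_apply_of_im_pos hw] using E2_slash_apply γ ⟨w, hw⟩
  have d := ((mdifferentiableAt_iff.mp (E2_mdifferentiable z)).hasDerivAt.sub
    ((hasDerivAt_denom_zpow (γ : GL (Fin 2) ℝ) (-1) z).const_mul
      (6 * Complex.I / Real.pi * (γ 1 0)))).congr_of_eventuallyEq e
  rw [normalizedDerivOfComplex, d.deriv, normalizedDerivOfComplex]
  simp only [Int.reduceNeg, Int.cast_neg, Int.cast_one, Int.reduceSub, mul_inv_rev,
    Complex.inv_I, zpow_neg, zpow_ofNat,
    Matrix.SpecialLinearGroup.coe_GL_coe_matrix, Matrix.SpecialLinearGroup.map_apply_coe,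
    RingHom.mapMatrix_apply, Int.coe_castRingHom, Matrix.map_apply, Complex.ofReal_intCast]
  linear_combination (-3 * (γ 1 0 : ℂ) ^ 2 / (Real.pi ^ 2 * denom γ z ^ 2)) * Complex.I_sq

open Derivative EisensteinSeries in
lemma normalizedDeriv_E2_slash (γ : SL(2, ℤ)) (z : ℍ) :
    (normalizedDerivOfComplex E2 ∣[(4 : ℤ)] γ) z = normalizedDerivOfComplex E2 z
      - 3 / Real.pi ^ 2 * (γ 1 0 / denom γ z) ^ 2
      - Complex.I / Real.pi * (γ 1 0 / denom γ z) * E2 z := by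
  have h1 := congrFun (normalizedDerivOfComplex_SL_slash (k := 2) E2_mdifferentiable (γ := γ)) z
  simp only [Pi.sub_apply, normalizedDeriv_slash_E2, E2_slash_apply, zpow_neg_one] at h1
  have hc : ((2 : ℤ) : ℂ) * (2 * Real.pi * Complex.I)⁻¹ = - Complex.I / Real.pi := by
    rw [mul_inv, mul_inv, Complex.inv_I]
    push_cast
    ring
  rw [hc] at h1
  rw [show (2 + 2 : ℤ) = 4 from rfl] at h1
  linear_combination -h1 + (6 * (γ 1 0 : ℂ) ^ 2 / (Real.pi ^ 2 * denom γ z ^ 2)) * Complex.I_sq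

open Derivative EisensteinSeries in
-- If `A` is the error term of `E₂` under `γ`, then `E₂²` gains `2 A E₂ + A²` and `D E₂` gains `A E₂
-- / 6 + A² / 12`; the factor `12` makes these cancel.
lemma E2_sq_sub_normalizedDeriv_slash (γ : SL(2, ℤ)) :
    (E2 * E2 - (12 : ℂ) • normalizedDerivOfComplex E2) ∣[(4 : ℤ)] γ
      = E2 * E2 - (12 : ℂ) • normalizedDerivOfComplex E2 := by
  have hmul := ModularForm.mul_slash_SL2 2 2 γ E2 E2
  ext z
  have hz : denom γ z ≠ 0 := denom_ne_zero γ z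
  have hpi : (Real.pi : ℂ) ≠ 0 := Complex.ofReal_ne_zero.2 Real.pi_ne_zero
  rw [sub_eq_add_neg, SlashAction.add_slash, SlashAction.neg_slash, ModularForm.SL_smul_slash]
  simp only [Pi.add_apply, Pi.neg_apply, Pi.smul_apply, Pi.mul_apply, normalizedDeriv_E2_slash]
  have hmul' : ((E2 * E2) ∣[(4 : ℤ)] γ) z = _ := congrFun hmul z
  rw [hmul', E2_slash_action]
  simp only [Pi.sub_apply, Pi.smul_apply, D2, riemannZeta_two, smul_eq_mul, Pi.mul_apply]
  have hc : 1 / (2 * ((Real.pi : ℂ) ^ 2 / 6)) * (2 * Real.pi * Complex.I * γ 1 0 / denom γ z) =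
      6 * Complex.I / Real.pi * (γ 1 0 / denom γ z) := by
    field_simp
  rw [hc]
  linear_combination (36 * (γ 1 0 : ℂ) ^ 2 / (Real.pi ^ 2 * denom γ z ^ 2)) * Complex.I_sq

open boundedPeriodic in
lemma isModularSeries_e2Series_sq_sub :
    IsModularSeries 4 (e2Series * e2Series - (12 : ℂ) • qDeriv e2Series) := by
  have hD := normalizedDeriv_mem E2_mem
  have h := IsModularSeries.of_slash_eq
    (boundedPeriodic.sub_mem (boundedPeriodic.mul_mem E2_mem E2_mem) (smul_mem 12 hD))
    E2_sq_sub_normalizedDeriv_slash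
  rwa [qExpansion_sub (analyticAt_cuspFunction (boundedPeriodic.mul_mem E2_mem E2_mem))
      (analyticAt_cuspFunction (smul_mem 12 hD)), qExpansion_smul (analyticAt_cuspFunction hD),
    qExpansion_mul (analyticAt_cuspFunction E2_mem) (analyticAt_cuspFunction E2_mem),
    qExpansion_normalizedDeriv E2_mem] at h

/-! ### Quasimodular polynomials and transcendence of `E₂` -/

open Polynomial

/-- A polynomial over power series is quasimodular of weight `w` if, the variable being given
weight `2`, it is homogeneous of weight `w` with modular coefficients. -/
def IsQuasimodularPoly (w : ℤ) (P : (PowerSeries ℂ)[X]) : Prop :=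
  ∀ j : ℕ, IsModularSeries (w - 2 * j) (P.coeff j)

lemma qExp_sum_E2_pow_mul {ι : Type*} (s : Finset ι) (e : ι → ℕ) {w : ι → ℤ}
    (F : (j : ι) → ModularForm 𝒮ℒ (w j)) {f : ℍ → ℂ}
    (hf : ∀ z, f z = ∑ j ∈ s, EisensteinSeries.E2 z ^ e j * F j z) :
    ∃ h : f ∈ boundedPeriodic,
      boundedPeriodic.qExp ⟨f, h⟩ = ∑ j ∈ s, e2Series ^ e j * qExpansion 1 (F j) := by
  let E : boundedPeriodic := ⟨_, boundedPeriodic.E2_mem⟩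
  let G (j : ι) : boundedPeriodic := ⟨_, boundedPeriodic.modularForm_mem (F j)⟩
  have hs : f = ((∑ j ∈ s, E ^ e j * G j : boundedPeriodic) : ℍ → ℂ) := by
    ext z
    simp [hf, E, G]
  have hmem : f ∈ boundedPeriodic := hs ▸ Subtype.property _
  refine ⟨hmem, ?_⟩
  rw [show (⟨f, hmem⟩ : boundedPeriodic) = ∑ j ∈ s, E ^ e j * G j from Subtype.ext hs]
  simp only [map_sum, map_mul, map_pow]
  rfl

/-- The matrix `(0, -1; 1, n)` acting on `ℍ` as `z ↦ -1 / (z + n)`. -/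
def invTranslate (n : ℤ) : SL(2, ℤ) := ⟨!![0, -1; 1, n], by simp [Matrix.det_fin_two]⟩

lemma denom_invTranslate (n : ℤ) (z : ℍ) : denom (invTranslate n) z = (z : ℂ) + n := by
  rw [ModularGroup.denom_apply]
  simp [invTranslate]

lemma E2_invTranslate_smul (n : ℤ) (z : ℍ) :
    EisensteinSeries.E2 (invTranslate n • z) = denom (invTranslate n) z ^ (2 : ℤ) *
      (EisensteinSeries.E2 z - 6 * Complex.I / Real.pi * ((z : ℂ) + n)⁻¹) := by
  have h := E2_slash_apply (invTranslate n) z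
  rw [ModularForm.SL_slash_apply, zpow_neg,
    mul_inv_eq_iff_eq_mul₀ (zpow_ne_zero _ (denom_ne_zero _ z))] at h
  rw [h, zpow_neg_one, denom_invTranslate]
  simp [invTranslate, mul_comm]

/-- `E₂` is transcendental over modular forms, weight by weight. -/
lemma eq_zero_of_sum_E2_pow_mul_eq_zero {w : ℤ} (n : ℕ)
    (F : (j : ℕ) → ModularForm 𝒮ℒ (w - 2 * (j : ℤ)))
    (h : ∀ z, ∑ j ∈ Finset.range n, EisensteinSeries.E2 z ^ j * F j z = 0) (j : ℕ) (hj : j < n) :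
    F j = 0 := by
  ext z
  -- With `z` fixed, the relation at `-1 / (z + m)` says, up to a power of the automorphy factor,
  -- that `Q` vanishes at `x m`. The lower-left entry is always `1`, so these points are distinct
  -- and `Q` has infinitely many roots.
  let Q : ℂ[X] := ∑ j ∈ Finset.range n, C (F j z) * X ^ j
  let x (m : ℕ) : ℂ := EisensteinSeries.E2 z - 6 * Complex.I / Real.pi * ((z : ℂ) + (m : ℤ))⁻¹
  have hx : Function.Injective x := by
    intro a b hab
    have hc : 6 * Complex.I / (Real.pi : ℂ) ≠ 0 := by simp [Real.pi_ne_zero]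
    simpa using mul_left_cancel₀ hc (sub_right_injective hab)
  have hroot (m : ℕ) : Q.eval (x m) = 0 := by
    have hd : denom (invTranslate m) z ≠ 0 := denom_ne_zero _ z
    have h1 := h (invTranslate m • z)
    have h2 : ∀ j ∈ Finset.range n, EisensteinSeries.E2 (invTranslate m • z) ^ j *
        F j (invTranslate m • z) = denom (invTranslate m) z ^ w * (F j z * x m ^ j) := by
      intro j _
      have h3 : F j (invTranslate m • z) = denom (invTranslate m) z ^ (w - 2 * (j : ℤ)) * F j z :=
        SlashInvariantForm.slash_action_eqn'' (Γ := 𝒮ℒ) (F j) ⟨invTranslate m, rfl⟩ z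
      rw [h3, E2_invTranslate_smul, mul_pow, ← zpow_natCast, ← zpow_mul]
      have h4 : denom (invTranslate m) z ^ w = denom (invTranslate m) z ^ (2 * (j : ℤ)) *
          denom (invTranslate m) z ^ (w - 2 * (j : ℤ)) := by
        rw [← zpow_add₀ hd]
        congr 1
        ring
      rw [h4]
      ring
    rw [Finset.sum_congr rfl h2, ← Finset.mul_sum] at h1
    simpa [Q, eval_finsetSum] using (mul_eq_zero.1 h1).resolve_left (zpow_ne_zero _ hd)
  have hQ : Q = 0 := Q.eq_zero_of_infinite_isRoot
    ((Set.infinite_range_of_injective hx).mono (Set.range_subset_iff.2 hroot))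
  have := congrArg (coeff · j) hQ
  simpa [Q, finsetSum_coeff, coeff_X_pow, hj] using this

namespace IsQuasimodularPoly

variable {w v : ℤ} {P Q : (PowerSeries ℂ)[X]}

lemma sub (hP : IsQuasimodularPoly w P) (hQ : IsQuasimodularPoly w Q) :
    IsQuasimodularPoly w (P - Q) := fun j => by
  simpa using (hP j).sub (hQ j)

lemma C_mul {φ : PowerSeries ℂ} (hφ : IsModularSeries v φ) (hP : IsQuasimodularPoly w P) :
    IsQuasimodularPoly (v + w) (C φ * P) := fun j => by
  simpa using (hφ.mul (hP j)).cast (by ring)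

lemma eq_zero_of_eval_eq_zero (hP : IsQuasimodularPoly w P) (h : P.eval e2Series = 0) : P = 0 := by
  choose F hF using hP
  obtain ⟨hmem, hq⟩ := qExp_sum_E2_pow_mul (Finset.range (P.natDegree + 1)) (fun j => j) F
    (fun z => rfl)
  have h0 : boundedPeriodic.qExp ⟨_, hmem⟩ = 0 := by
    rw [hq, ← h, eval_eq_sum_range]
    exact Finset.sum_congr rfl fun j _ => by rw [hF, mul_comm]
  have hz := congrArg Subtype.val
    ((injective_iff_map_eq_zero _).1 boundedPeriodic.qExp_injective _ h0)
  ext1 j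
  by_cases hj : j < P.natDegree + 1
  · rw [← hF, eq_zero_of_sum_E2_pow_mul_eq_zero _ F (fun z => congrFun hz z) j hj]
    simpa using qExpansion_zero 1
  · simpa using coeff_eq_zero_of_natDegree_lt (by omega)

end IsQuasimodularPoly

/-! ### The Serre-type derivative on polynomials in `E₂` -/

/-- Coefficientwise application of `q d/dq`. -/
noncomputable def coeffDeriv : (PowerSeries ℂ)[X] →ₗ[ℂ] (PowerSeries ℂ)[X] :=
  lsum fun n => ((monomial n).restrictScalars ℂ).comp (qDeriv : PowerSeries ℂ →ₗ[ℂ] PowerSeries ℂ)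

lemma coeffDeriv_monomial (n : ℕ) (a : PowerSeries ℂ) :
    coeffDeriv (monomial n a) = monomial n (qDeriv a) := by
  simp [coeffDeriv, lsum_apply]

lemma coeff_coeffDeriv (P : (PowerSeries ℂ)[X]) (j : ℕ) :
    (coeffDeriv P).coeff j = qDeriv (P.coeff j) := by
  induction P using Polynomial.induction_on' with
  | add P Q hP hQ => simp [hP, hQ]
  | monomial n a =>
    rw [coeffDeriv_monomial, coeff_monomial, coeff_monomial]
    split_ifs <;> simp

lemma qDeriv_eval (x : PowerSeries ℂ) (P : (PowerSeries ℂ)[X]) :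
    qDeriv (P.eval x) = (coeffDeriv P).eval x + (derivative P).eval x * qDeriv x := by
  induction P using Polynomial.induction_on' with
  | add P Q hP hQ => simp only [eval_add, map_add, hP, hQ]; ring
  | monomial n a =>
    rw [coeffDeriv_monomial, derivative_monomial]
    simp only [eval_monomial, Derivation.leibniz, Derivation.leibniz_pow, smul_eq_mul, nsmul_eq_mul]
    ring

/-- The `q`-expansion of a modular form of weight `4` (a multiple of the Eisenstein series), written
in terms of `E₂`. -/
noncomputable def e4Series : PowerSeries ℂ := e2Series * e2Series - (12 : ℂ) • qDeriv e2Series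

lemma coeff_X_mul_derivative {R : Type*} [CommRing R] (P : R[X]) (j : ℕ) :
    (X * derivative P).coeff j = j * P.coeff j := by
  cases j with
  | zero => simp
  | succ j => simp [coeff_X_mul, coeff_derivative, mul_comm]

/-- The operator on quasimodular polynomials of weight `w` and degree at most `p` corresponding to
`f ↦ q df/dq - (w - p) / 12 * E₂ * f`. -/
noncomputable def serrePoly (w p : ℂ) (P : (PowerSeries ℂ)[X]) : (PowerSeries ℂ)[X] :=
  coeffDeriv P - (w / 12) • (C e2Series * P) +
    (2 / 12 : ℂ) • (C e2Series * (X * derivative P)) + (p / 12) • (X * P) -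
    (1 / 12 : ℂ) • (X * (X * derivative P)) - (1 / 12 : ℂ) • (C e4Series * derivative P)

lemma coeff_zero_serrePoly (w p : ℂ) (P : (PowerSeries ℂ)[X]) :
    (serrePoly w p P).coeff 0 = qDeriv (P.coeff 0) - (w / 12) • (e2Series * P.coeff 0)
      - (1 / 12 : ℂ) • (e4Series * P.coeff 1) := by
  simp [serrePoly, coeff_coeffDeriv, coeff_derivative]

lemma C_twelve_inv_mul : PowerSeries.C (12⁻¹ : ℂ) * 12 = 1 := by
  rw [← map_ofNat PowerSeries.C 12, ← map_mul]
  simp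

lemma e4Series_def : e4Series = e2Series * e2Series - 12 * qDeriv e2Series := by
  rw [e4Series, PowerSeries.smul_eq_C_mul, map_ofNat]

/-- The mixture of `C e2Series` and `X` in `serrePoly` is chosen so that each coefficient involves
the Serre derivative of its own weight and so stays modular. The factor `p - j` stops the degree
from rising above `p`. -/
lemma coeff_succ_serrePoly (w p : ℂ) (P : (PowerSeries ℂ)[X]) (j : ℕ) :
    (serrePoly w p P).coeff (j + 1) = qDeriv (P.coeff (j + 1))
      - ((w - 2 * (j + 1)) / 12) • (e2Series * P.coeff (j + 1))
      + ((p - j) / 12) • P.coeff j - ((j + 2) / 12 : ℂ) • (e4Series * P.coeff (j + 2)) := by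
  simp only [serrePoly, coeff_sub, coeff_add, coeff_smul, coeff_C_mul, coeff_X_mul,
    coeff_X_mul_derivative, coeff_derivative, coeff_coeffDeriv,
    PowerSeries.smul_eq_C_mul, div_eq_mul_inv, map_mul, map_sub, map_add, map_ofNat, map_natCast,
    map_one]
  push_cast
  ring

lemma IsQuasimodularPoly.serrePoly {w : ℤ} {P : (PowerSeries ℂ)[X]} (hP : IsQuasimodularPoly w P)
    (p : ℂ) : IsQuasimodularPoly (w + 2) (serrePoly w p P) := by
  have h4 : IsModularSeries 4 e4Series := isModularSeries_e2Series_sq_sub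
  rintro (_ | j)
  · rw [coeff_zero_serrePoly]
    refine .sub ?_ (((h4.mul (hP 1)).cast (by push_cast; ring)).smul _)
    simpa using (hP 0).serre
  · rw [coeff_succ_serrePoly]
    refine .sub (.add ?_ (((hP j).cast (by push_cast; ring)).smul _))
      (((h4.mul (hP (j + 2))).cast (by push_cast; ring)).smul _)
    have := ((hP (j + 1)).serre).cast (v := w + 2 - 2 * ((j + 1 : ℕ) : ℤ)) (by ring)
    simpa using this

lemma eval_serrePoly (w p : ℂ) (P : (PowerSeries ℂ)[X]) :
    (serrePoly w p P).eval e2Series = qDeriv (P.eval e2Series) -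
      ((w - p) / 12) • (e2Series * P.eval e2Series) := by
  have h := qDeriv_eval e2Series P
  simp only [serrePoly, eval_sub, eval_add, eval_smul, eval_mul, eval_C, eval_X, h,
    PowerSeries.smul_eq_C_mul, div_eq_mul_inv, map_mul, map_sub, map_ofNat, map_one]
  linear_combination ((derivative P).eval e2Series) * qDeriv e2Series * C_twelve_inv_mul -
    PowerSeries.C 12⁻¹ * (derivative P).eval e2Series * e4Series_def

/-- Formal differentiation in `E₂` commutes with the operator up to the extra term `(p / 12) f`,
which drives the contradiction. -/
lemma eval_derivative_serrePoly (w p : ℂ) (P : (PowerSeries ℂ)[X]) :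
    (derivative (serrePoly w p P)).eval e2Series = qDeriv ((derivative P).eval e2Series) -
      ((w - p) / 12) • (e2Series * (derivative P).eval e2Series) +
      (p / 12) • P.eval e2Series := by
  have h := qDeriv_eval e2Series (derivative P)
  have hc : derivative (coeffDeriv P) = coeffDeriv (derivative P) := by
    ext1 j
    simp [coeff_derivative, coeff_coeffDeriv, mul_comm]
  simp only [serrePoly, derivative_smul, derivative_mul,
    derivative_C, derivative_X, hc, eval_sub, eval_add, eval_smul, eval_mul, eval_C, eval_X, h,
    PowerSeries.smul_eq_C_mul, eval_zero, eval_one, div_eq_mul_inv, map_mul, map_sub,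
    map_add, map_ofNat, map_one]
  linear_combination ((derivative (derivative P)).eval e2Series) * qDeriv e2Series * C_twelve_inv_mul -
    PowerSeries.C 12⁻¹ * (derivative (derivative P)).eval e2Series * e4Series_def

/-! ### Orders of vanishing under `q d/dq` -/

lemma X_pow_dvd_qDeriv {φ : PowerSeries ℂ} {N : ℕ} (h : PowerSeries.X ^ N ∣ φ) :
    PowerSeries.X ^ N ∣ qDeriv φ := by
  rw [PowerSeries.X_pow_dvd_iff] at h ⊢
  intro m hm
  rw [coeff_qDeriv, h m hm, mul_zero]

lemma qDeriv_X_pow_mul (n : ℕ) (u : PowerSeries ℂ) :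
    qDeriv (PowerSeries.X ^ n * u) = PowerSeries.X ^ n * ((n : PowerSeries ℂ) * u + qDeriv u) := by
  have hX : qDeriv PowerSeries.X = (PowerSeries.X : PowerSeries ℂ) := by simp [qDeriv_apply]
  cases n with
  | zero => simp
  | succ n =>
    rw [Derivation.leibniz, Derivation.leibniz_pow, hX]
    simp only [Nat.add_sub_cancel, smul_eq_mul, nsmul_eq_mul]
    ring

lemma exists_eq_X_pow_mul {φ : PowerSeries ℂ} (hφ : φ ≠ 0) :
    ∃ (n : ℕ) (u : PowerSeries ℂ), u.constantCoeff ≠ 0 ∧ φ = PowerSeries.X ^ n * u := by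
  obtain ⟨u, hu⟩ := PowerSeries.X_pow_order_dvd (φ := φ)
  refine ⟨_, u, fun h0 => ?_, hu⟩
  obtain ⟨v, rfl⟩ := PowerSeries.X_dvd_iff.2 h0
  have h1 : PowerSeries.X ^ (φ.order.toNat + 1) ∣ φ := ⟨v, by rw [pow_succ, mul_assoc]; exact hu⟩
  have h2 := PowerSeries.coeff_order hφ
  exact h2 (PowerSeries.X_pow_dvd_iff.1 h1 _ (Nat.lt_succ_self _))

/-- A nonzero constant is not of the form `q d/dq` applied to a ratio of power series. -/
lemma mul_qDeriv_sub_ne {f g : PowerSeries ℂ} (hf : f ≠ 0) {c : ℂ} (hc : c ≠ 0) :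
    g * qDeriv f - f * qDeriv g ≠ c • (f * f) := by
  intro h
  rw [PowerSeries.smul_eq_C_mul] at h
  have hC : PowerSeries.C c ≠ 0 := by simpa using hc
  have hg : g ≠ 0 := by
    rintro rfl
    simp [hf, hC] at h
  obtain ⟨n, u, hu, rfl⟩ := exists_eq_X_pow_mul hf
  obtain ⟨m, v, hv, rfl⟩ := exists_eq_X_pow_mul hg
  rw [qDeriv_X_pow_mul, qDeriv_X_pow_mul] at h
  have hX : (PowerSeries.X : PowerSeries ℂ) ≠ 0 := PowerSeries.X_ne_zero
  have hD (x : PowerSeries ℂ) : (qDeriv x).constantCoeff = 0 := by simp [qDeriv_apply]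
  have key : PowerSeries.X ^ m *
      (((n : PowerSeries ℂ) - (m : PowerSeries ℂ)) * u * v + v * qDeriv u - u * qDeriv v) =
      PowerSeries.X ^ n * (PowerSeries.C c * (u * u)) :=
    mul_left_cancel₀ (pow_ne_zero n hX) (by linear_combination h)
  -- Compare constant terms after removing the smaller power of `q`. If `m < n`, then `(n - m) u v`
  -- would have to vanish; if `m ≥ n`, the left side contributes `0` against `c u²`.
  rcases lt_trichotomy m n with hmn | rfl | hmn
  · obtain ⟨d, rfl⟩ := Nat.exists_eq_add_of_lt hmn
    rw [add_assoc, pow_add, mul_assoc (PowerSeries.X ^ m)] at key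
    have := congrArg PowerSeries.constantCoeff (mul_left_cancel₀ (pow_ne_zero m hX) key)
    simp [hD, hu, hv] at this
    exact Nat.cast_add_one_ne_zero d this
  · have := congrArg PowerSeries.constantCoeff (mul_left_cancel₀ (pow_ne_zero m hX) key)
    simp [hD, hu, hc] at this
  · obtain ⟨d, rfl⟩ := Nat.exists_eq_add_of_lt hmn
    rw [add_assoc, pow_add, mul_assoc (PowerSeries.X ^ n)] at key
    have := congrArg PowerSeries.constantCoeff (mul_left_cancel₀ (pow_ne_zero n hX) key)
    simp [hu, hc] at this

/-! ### The zero estimate -/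

namespace IsQuasimodularPoly

/-- A nonzero quasimodular polynomial of positive degree is not proportional to its Serre derivative
over power series. -/
lemma eq_zero_of_C_mul_serrePoly_eq {w : ℤ} {P : (PowerSeries ℂ)[X]} (hP : IsQuasimodularPoly w P)
    {p : ℂ} (hp : p ≠ 0) {φ τ : PowerSeries ℂ} (hφ : φ ≠ 0)
    (h : C φ * _root_.serrePoly w p P = C τ * P) : P = 0 := by
  refine hP.eq_zero_of_eval_eq_zero (by_contra fun hf => ?_)
  have h1 := congrArg (eval e2Series) h
  have h2 := congrArg (fun Q => (derivative Q).eval e2Series) h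
  simp only [derivative_C_mul, eval_mul, eval_C, eval_serrePoly, eval_derivative_serrePoly,
    PowerSeries.smul_eq_C_mul] at h1 h2
  refine mul_qDeriv_sub_ne (g := (derivative P).eval e2Series) hf
    (div_ne_zero hp (by norm_num : (12 : ℂ) ≠ 0)) (mul_left_cancel₀ hφ ?_)
  rw [PowerSeries.smul_eq_C_mul]
  -- This combination eliminates the unknown multiplier `τ`.
  linear_combination ((derivative P).eval e2Series) * h1 - (P.eval e2Series) * h2

/-- Each elimination lowers the degree by one and at most doubles the weight, whence the factor `2 ^
p` in front of the Sturm bound. -/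
lemma eq_zero_of_X_pow_dvd_eval (p : ℕ) {w : ℤ} {P : (PowerSeries ℂ)[X]} {N : ℕ}
    (hdeg : P.natDegree ≤ p) (hP : IsQuasimodularPoly w P) (hN : 2 ^ p * w.toNat / 12 < N)
    (h : PowerSeries.X ^ N ∣ P.eval e2Series) : P = 0 := by
  induction p generalizing w P with
  | zero =>
    rw [eq_C_of_natDegree_le_zero hdeg] at h ⊢
    rw [eval_C] at h
    rw [((hP 0).cast (v := w) (by simp)).eq_zero_of_X_pow_dvd (by simpa using hN) h, C_0]
  | succ p ih =>
    have htop : ∀ j, p + 1 < j → P.coeff j = 0 := natDegree_le_iff_coeff_eq_zero.1 hdeg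
    have hpow : 2 ^ (p + 1) * w.toNat = 2 ^ p * (2 * w.toNat) := by ring
    by_cases hφ : P.coeff (p + 1) = 0
    · refine ih (natDegree_le_iff_coeff_eq_zero.2 fun j hj => ?_) hP
        (lt_of_le_of_lt (Nat.div_le_div_right ?_) hN) h
      · rcases (Nat.succ_le_of_lt hj).eq_or_lt with rfl | hj
        · exact hφ
        · exact htop j hj
      · rw [hpow]
        exact Nat.mul_le_mul_left _ (by omega)
    · set T := _root_.serrePoly w ((p + 1 : ℕ) : ℂ) P with hT
      have hTQ : IsQuasimodularPoly (w + 2) T := hP.serrePoly _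
      have hTtop : ∀ j, p + 1 < j → T.coeff j = 0 := by
        rintro (_ | j) hj
        · omega
        · rw [hT, coeff_succ_serrePoly, htop (j + 1) hj, htop (j + 2) (by omega)]
          rcases (show p + 1 ≤ j by omega).eq_or_lt with rfl | hj'
          · simp
          · simp [htop j hj']
      refine hP.eq_zero_of_C_mul_serrePoly_eq (p := ((p + 1 : ℕ) : ℂ)) (τ := T.coeff (p + 1))
        (Nat.cast_ne_zero.2 p.succ_ne_zero) hφ (sub_eq_zero.1 ?_)
      rw [← hT]
      -- The weight is that of the leading coefficient, `w - 2 (p + 1)`, plus that of `T`, `w + 2`.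
      refine ih (w := 2 * w - 2 * p) (natDegree_le_iff_coeff_eq_zero.2 fun j hj => ?_)
        (.sub ?_ ?_) (lt_of_le_of_lt (Nat.div_le_div_right ?_) hN) ?_
      · rw [coeff_sub, coeff_C_mul, coeff_C_mul]
        rcases (Nat.succ_le_of_lt hj).eq_or_lt with rfl | hj
        · exact sub_eq_zero.2 (mul_comm _ _)
        · rw [hTtop j hj, htop j hj, mul_zero, mul_zero, sub_zero]
      · convert! hTQ.C_mul (hP (p + 1)) using 1
        push_cast
        ring
      · convert! hP.C_mul (hTQ (p + 1)) using 1
        push_cast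
        ring
      · rw [hpow]
        exact Nat.mul_le_mul_left _ (by omega)
      · rw [eval_sub, eval_mul, eval_mul, eval_C, eval_C, hT, eval_serrePoly,
          PowerSeries.smul_eq_C_mul]
        exact dvd_sub (((X_pow_dvd_qDeriv h).sub ((h.mul_left _).mul_left _)).mul_left _)
          (h.mul_left _)

end IsQuasimodularPoly

/-! ### Application to quasimodular forms -/

lemma IsQuasimodular.exists_poly {k : ℕ} {f : ℍ → ℂ} (hf : IsQuasimodular k f) :
    ∃ P : (PowerSeries ℂ)[X], P.natDegree ≤ k ∧ IsQuasimodularPoly (2 * k) P ∧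
      ∃ h : f ∈ boundedPeriodic, boundedPeriodic.qExp ⟨f, h⟩ = P.eval e2Series := by
  obtain ⟨F, hF⟩ := hf
  obtain ⟨hmem, hq⟩ := qExp_sum_E2_pow_mul Finset.univ (fun j : Fin (k + 1) => (j : ℕ)) F hF
  refine ⟨∑ j : Fin (k + 1), monomial (j : ℕ) (qExpansion 1 (F j)), ?_, fun n => ?_, hmem, ?_⟩
  · exact natDegree_sum_le_of_forall_le _ _ fun j _ =>
      (natDegree_monomial_le _).trans (Nat.lt_succ_iff.1 j.2)
  · rw [finsetSum_coeff]
    refine Finset.sum_induction _ (IsModularSeries _) (fun _ _ => .add) (.zero _) fun j _ => ?_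
    rw [coeff_monomial]
    split_ifs with h
    · exact h ▸ ⟨F j, rfl⟩
    · exact .zero _
  · rw [hq, eval_finsetSum]
    exact Finset.sum_congr rfl fun j _ => by rw [eval_monomial, mul_comm]

lemma two_pow_mul_div_lt {k : ℕ} (hk : 1 ≤ k) :
    2 ^ k * (2 * k) / 12 < k ^ 2 * k ^ k * k ^ (k ^ k) := by
  rcases hk.eq_or_lt with rfl | hk
  · norm_num
  · have h1 : 2 ^ k ≤ k ^ k := Nat.pow_le_pow_left hk k
    have h2 : 2 * k ≤ k ^ 2 := by nlinarith
    have h3 : 1 ≤ k ^ (k ^ k) := Nat.one_le_pow _ _ (by omega)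
    have h4 : 0 < 2 ^ k * (2 * k) := by positivity
    calc 2 ^ k * (2 * k) / 12 < 2 ^ k * (2 * k) := Nat.div_lt_self h4 (by norm_num)
      _ ≤ k ^ k * k ^ 2 := Nat.mul_le_mul h1 h2
      _ = k ^ 2 * k ^ k * 1 := by ring
      _ ≤ _ := Nat.mul_le_mul_left _ h3

theorem proposition5p1 (k : ℕ) (hk : 1 ≤ k) (f g : ℍ → ℂ)
    (hf : IsIntegralQuasimodular k f) (hg : IsIntegralQuasimodular k g)
    (hfg : ∀ n : ℕ, n < k ^ 2 * k ^ k * k ^ (k ^ k) → qCoeff f n = qCoeff g n) :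
    f = g := by
  obtain ⟨P, hPdeg, hP, hfm, hfP⟩ := hf.1.exists_poly
  obtain ⟨Q, hQdeg, hQ, hgm, hgQ⟩ := hg.1.exists_poly
  have hPQ : P - Q = 0 := by
    refine (hP.sub hQ).eq_zero_of_X_pow_dvd_eval k
      ((natDegree_sub_le P Q).trans (max_le hPdeg hQdeg)) (two_pow_mul_div_lt hk)
      (PowerSeries.X_pow_dvd_iff.2 fun n hn => ?_)
    rw [eval_sub, ← hfP, ← hgQ, map_sub]
    exact sub_eq_zero.2 (hfg n hn)
  have := boundedPeriodic.qExp_injective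
    (hfP.trans ((congrArg _ (sub_eq_zero.1 hPQ)).trans hgQ.symm))
  exact congrArg Subtype.val this
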